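/- Consider a finite, fully connected network of nodes communicating in synchronous rounds. Every node has one duplex port: in each round a node may send data that it holds at the start of the round to at most one other node and may receive data from at most one other node, both at the same time. A communication algorithm with $C_1$ rounds, in which $b_i$ is the maximum number of symbols sent from one node to another in round $i$, has cost $C_1\alpha+C_2\beta$, where $C_2=\sum_{i=1}^{C_1} b_i$ and $\alpha,\beta\ge 0$ are given. Messages are divisible: each may be split into finitely many packets of arbitrary nonnegative real sizes (measured in symbols) that add up to the size of the message. In multi-broadcast$(p,r,n)$ there are $r$ distinct broadcasting nodes and a set of $p$ distinct destination nodes (a broadcasting node may or may not be a destination node as well). Initially the $i$-th broadcasting node holds a message $M_i$ of $n$ symbols, and no other data is present. At the end every one of the $p$ destination nodes must have all $r$ messages $M_1,\dots,M_r$. **Theorem.** Let $1\le r\le p$, $p\ge 2$, $n\ge 0$ be integers and let $\alpha,\beta\ge0$. For every choice of the broadcasting nodes and of the destination nodes, multi-broadcast$(p,r,n)$ can be done with communication cost at most $$2\left(\lceil \log_2 p\rceil\,\alpha + r n\,\beta\right).$$ -/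

import Mathlib

open scoped NNReal BigOperators

/-- A splitting of `r` messages, each of `n` symbols, into packets. Data is divisible: packet `k` of
message `i` has an arbitrary nonnegative size (measured in symbols), and the sizes of the packets of
each message add up to `n`. -/
structure Packetization (r n : ℕ) where
  count : ℕ
  size : Fin r → Fin count → ℝ≥0
  sum_size : ∀ i, ∑ k, size i k = (n : ℝ≥0)

/-- The pair `(i, k)` names the `k`-th packet of the `i`-th message. -/
abbrev Packetization.Packet {r n : ℕ} (P : Packetization r n) : Type :=
  Fin r × Fin P.count

/-- One communication round in a fully connected network with node set `V`, every node having one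
duplex port. `send u = some (v, B)` means that node `u` sends the packets in `B` to node `v`;
`send u = none` means that `u` sends nothing. A node sends to at most one node (by the type of
`send`) and receives from at most one node (`one_port`); it may do both in the same round. Any
ordered pair of distinct nodes may communicate. -/
structure CommRound (V ι : Type*) where
  send : V → Option (V × Finset ι)
  not_self : ∀ u v B, send u = some (v, B) → u ≠ v
  one_port : ∀ u u' v B B', send u = some (v, B) → send u' = some (v, B') → u = u'

namespace CommRound

variable {V ι : Type*}

/-- A node can only send packets that it holds at the start of the round. -/
def Feasible (R : CommRound V ι) (H : V → Set ι) : Prop :=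
  ∀ u v B, R.send u = some (v, B) → ∀ x ∈ B, x ∈ H u

/-- The packets held by each node after the round: those held before and those received. -/
def next (R : CommRound V ι) (H : V → Set ι) : V → Set ι :=
  fun v => H v ∪ {x | ∃ u B, R.send u = some (v, B) ∧ x ∈ B}

/-- The total size of what node `u` sends in the round. -/
def sentSize (R : CommRound V ι) (w : ι → ℝ≥0) (u : V) : ℝ≥0 :=
  match R.send u with
  | none => 0
  | some (_, B) => ∑ x ∈ B, w x

/-- The maximum number of symbols communicated between two nodes in the round. -/
def volume [Fintype V] (R : CommRound V ι) (w : ι → ℝ≥0) : ℝ≥0 :=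
  Finset.univ.sup (R.sentSize w)

end CommRound

namespace Schedule

variable {V ι : Type*}

/-- The packets held by each node after all rounds have been executed in order. -/
def final : List (CommRound V ι) → (V → Set ι) → (V → Set ι)
  | [], H => H
  | R :: L, H => final L (R.next H)

/-- Every round is feasible for the packets held when it starts. -/
def Feasible : List (CommRound V ι) → (V → Set ι) → Prop
  | [], _ => True
  | R :: L, H => R.Feasible H ∧ Feasible L (R.next H)

/-- The cost `C₁ α + C₂ β`, where `C₁` is the number of rounds and `C₂` is the sum over the rounds of
the maximum number of symbols communicated between two nodes. -/
def cost [Fintype V] (α β : ℝ) (w : ι → ℝ≥0) (L : List (CommRound V ι)) : ℝ :=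
  (L.length : ℝ) * α + (((L.map fun R => R.volume w).sum : ℝ≥0) : ℝ) * β

end Schedule

/-- In the beginning node `src i` holds all packets of message `i`, and nothing else is held. -/
def initialHoldings {V : Type*} {r n : ℕ} (src : Fin r → V) (P : Packetization r n) :
    V → Set P.Packet :=
  fun v => {x | src x.1 = v}

/-- The messages `M₁, …, M_r` of `n` symbols each, held by the nodes `src 1, …, src r`, can all be
delivered to every node in `D` at communication cost at most `c`. -/
def MultiBroadcastWithin {V : Type*} [Fintype V] {r : ℕ} (src : Fin r → V) (D : Finset V) (n : ℕ)
    (α β c : ℝ) : Prop :=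
  ∃ (P : Packetization r n) (L : List (CommRound V P.Packet)),
    Schedule.Feasible L (initialHoldings src P) ∧
    (∀ d ∈ D, ∀ x : P.Packet, x ∈ Schedule.final L (initialHoldings src P) d) ∧
    Schedule.cost α β (fun x : P.Packet => P.size x.1 x.2) L ≤ c

/-!
Every message is cut into equal packets, the packets are scattered over the destinations so that
each destination owns at most one of them, and the destinations then run an all-gather on a
circulant graph. Write `k = ⌈log₂ p⌉`.

* All-gather (`exists_allGather`). The destinations are indexed by `ℤ/p`. After `t` rounds slot `a`
  knows the packets owned by the slots `a, …, a + 2 ^ t - 1`; in the next round it receives from slot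
  `a + 2 ^ t` the following `min (2 ^ t) (p - 2 ^ t)` packets. After `k` rounds everybody knows
  everything, and the volumes add up to at most `p - 1` packets, for arbitrary `p`.
* Scatter (`exists_scatter`). Within a group of `Q ≤ 2 ^ T` slots, slot `0` distributes its packets
  along a binomial tree in `T` rounds, of total volume at most `Q - 1` packets; any number of disjoint
  groups do so simultaneously.

For `r ≥ 2` put `q = ⌊p / r⌋`, cut each message into `q` packets and choose `r` disjoint groups of `q`
destinations. A first round of volume `n` moves message `i` from its source to the head of group `i`,
which makes it irrelevant whether a source is a destination. As `q ≤ 2 ^ (k - 1)`, the scatter takes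
`k - 1` rounds and volume at most `n`. The all-gather takes `k` rounds and volume
`(p - 1) n / q ≤ (r + (r - 2) / q) n ≤ (2 r - 2) n`, since `p ≤ r q + r - 1`. The sum is at most
`2 k` rounds and volume `2 r n`.

For `r = 1` there is no round to spare for moving the message into the set of destinations. Instead,
the message is cut into `p - 1` packets, owned by all slots but slot `0`. The source acts as the sender
of slot `0`, in both phases, while the receiver of slot `0` is a destination `d`, chosen to be the
source itself if that is a destination. The source never needs to receive anything, so whatever is
addressed to slot `0` may go to `d`. Both phases take `k` rounds and have volume at most `n`.
-/

/-! ### Rounds given by families of transfers -/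

/-- A family of transfers with distinct senders and distinct receivers is realised by a round in
which each sender transmits the part of the prescribed set that it holds. A transfer from a node to
itself is allowed: it is dropped, without any effect on the holdings. -/
theorem CommRound.exists_of_transfers {V ι κ : Type*} [Fintype V] (s d : κ → V)
    (hs : Function.Injective s) (hd : Function.Injective d) (B : κ → Finset ι) (w : ι → ℝ≥0)
    (m : ℝ≥0) (hm : ∀ c, ∑ x ∈ B c, w x ≤ m) (H : V → Set ι) :
    ∃ R : CommRound V ι, R.Feasible H ∧ R.volume w ≤ m ∧ (∀ v, H v ⊆ R.next H v) ∧
      ∀ c, ∀ x ∈ B c, x ∈ H (s c) → x ∈ R.next H (d c) := by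
  classical
  let f : V → Option (V × Finset ι) := fun u =>
    if h : ∃ c, s c = u ∧ u ≠ d c then some (d h.choose, (B h.choose).filter (· ∈ H u)) else none
  have hf : ∀ u v A, f u = some (v, A) →
      ∃ c, s c = u ∧ d c = v ∧ u ≠ v ∧ A = (B c).filter (· ∈ H u) := by
    intro u v A h
    by_cases h' : ∃ c, s c = u ∧ u ≠ d c
    · simp only [f, dif_pos h', Option.some.injEq, Prod.mk.injEq] at h
      obtain ⟨rfl, rfl⟩ := h
      exact ⟨_, h'.choose_spec.1, rfl, h'.choose_spec.2, rfl⟩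
    · simp [f, dif_neg h'] at h
  have hf' : ∀ c, s c ≠ d c → f (s c) = some (d c, (B c).filter (· ∈ H (s c))) := by
    intro c hc
    have h' : ∃ c', s c' = s c ∧ s c ≠ d c' := ⟨c, rfl, hc⟩
    have e : h'.choose = c := hs h'.choose_spec.1
    simp only [f, dif_pos h', e]
  refine ⟨⟨f, ?_, ?_⟩, ?_, ?_, ?_, ?_⟩
  · intro u v A h
    obtain ⟨c, -, -, h, -⟩ := hf u v A h
    exact h
  · intro u u' v A A' h h'
    obtain ⟨c, rfl, hc, -⟩ := hf _ _ _ h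
    obtain ⟨c', rfl, hc', -⟩ := hf _ _ _ h'
    rw [hd (hc.trans hc'.symm)]
  · intro u v A h x hx
    obtain ⟨c, -, -, -, rfl⟩ := hf u v A h
    exact (Finset.mem_filter.1 hx).2
  · refine Finset.sup_le fun u _ => ?_
    unfold CommRound.sentSize
    split
    · exact zero_le
    · rename_i v A h
      obtain ⟨c, -, -, -, rfl⟩ := hf u v A h
      exact (Finset.sum_le_sum_of_subset (Finset.filter_subset _ _)).trans (hm c)
  · exact fun v => Set.subset_union_left
  · intro c x hx hxs
    by_cases hc : s c = d c
    · exact Or.inl (hc ▸ hxs)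
    · exact Or.inr ⟨s c, _, hf' c hc, Finset.mem_filter.2 ⟨hx, hxs⟩⟩

/-! ### Composing schedules -/

/-- `Reaches w m C H H'`: some feasible schedule of `m` rounds and total volume at most `C`, packet
`x` having size `w x`, turns the holdings `H` into exactly `H'`. -/
def Reaches {V ι : Type*} [Fintype V] (w : ι → ℝ≥0) (m : ℕ) (C : ℝ≥0) (H H' : V → Set ι) : Prop :=
  ∃ L : List (CommRound V ι), Schedule.Feasible L H ∧ Schedule.final L H = H' ∧ L.length = m ∧
    (L.map fun R => R.volume w).sum ≤ C

namespace Reaches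

variable {V ι : Type*} [Fintype V] {w : ι → ℝ≥0}

theorem refl (H : V → Set ι) : Reaches w 0 0 H H :=
  ⟨[], trivial, rfl, rfl, by simp⟩

theorem of_round {R : CommRound V ι} {H : V → Set ι} {C : ℝ≥0} (h : R.Feasible H)
    (hC : R.volume w ≤ C) : Reaches w 1 C H (R.next H) :=
  ⟨[R], ⟨h, trivial⟩, rfl, rfl, by simpa using hC⟩

theorem trans {m m' : ℕ} {C C' : ℝ≥0} {H H' H'' : V → Set ι} (h : Reaches w m C H H')
    (h' : Reaches w m' C' H' H'') : Reaches w (m + m') (C + C') H H'' := by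
  obtain ⟨L, hL, rfl, rfl, hC⟩ := h
  obtain ⟨L', hL', rfl, rfl, hC'⟩ := h'
  have key : ∀ (L : List (CommRound V ι)) (H : V → Set ι), Schedule.Feasible L H →
      Schedule.Feasible L' (Schedule.final L H) →
      Schedule.Feasible (L ++ L') H ∧
        Schedule.final (L ++ L') H = Schedule.final L' (Schedule.final L H) := by
    intro L
    induction L with
    | nil => exact fun H _ h => ⟨h, rfl⟩
    | cons R L ih => exact fun H h h' => ⟨⟨h.1, (ih _ h.2 h').1⟩, (ih _ h.2 h').2⟩
  refine ⟨L ++ L', (key L H hL hL').1, (key L H hL hL').2, by simp, ?_⟩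
  rw [List.map_append, List.sum_append]
  exact add_le_add hC hC'

end Reaches

/-- A round of transfers, as a one-step schedule. -/
theorem exists_reaches_of_transfers {V ι κ : Type*} [Fintype V] (s d : κ → V)
    (hs : Function.Injective s) (hd : Function.Injective d) (B : κ → Finset ι) (w : ι → ℝ≥0)
    (m : ℝ≥0) (hm : ∀ c, ∑ x ∈ B c, w x ≤ m) (H : V → Set ι) :
    ∃ H', Reaches w 1 m H H' ∧ (∀ v, H v ⊆ H' v) ∧
      ∀ c, ∀ x ∈ B c, x ∈ H (s c) → x ∈ H' (d c) := by
  obtain ⟨R, h1, h2, h3, h4⟩ := CommRound.exists_of_transfers s d hs hd B w m hm H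
  exact ⟨_, Reaches.of_round h1 h2, h3, h4⟩

theorem MultiBroadcastWithin.of_reaches {V : Type*} [Fintype V] {r n : ℕ} {src : Fin r → V}
    {D : Finset V} {α β c : ℝ} (hα : 0 ≤ α) (hβ : 0 ≤ β) (P : Packetization r n) {m k : ℕ}
    {C : ℝ≥0} {H : V → Set P.Packet}
    (hH : Reaches (fun x : P.Packet => P.size x.1 x.2) m C (initialHoldings src P) H)
    (hD : ∀ d ∈ D, ∀ x, x ∈ H d) (hm : m ≤ k) (hc : k * α + C * β ≤ c) :
    MultiBroadcastWithin src D n α β c := by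
  obtain ⟨L, hL, rfl, rfl, hC⟩ := hH
  refine ⟨P, L, hL, hD, le_trans ?_ hc⟩
  unfold Schedule.cost
  have h1 : (L.length : ℝ) ≤ k := by exact_mod_cast hm
  have h2 := NNReal.coe_le_coe.2 hC
  gcongr

/-! ### Doubling -/

/-- An upper bound for the number of packets sent by a slot in round `t` of the doubling schemes on
`Q` slots. -/
def doublingLoad (Q t : ℕ) : ℕ := min (2 ^ t) (Q - 2 ^ t)

theorem sum_doublingLoad_le (Q T : ℕ) : ∑ t ∈ Finset.range T, doublingLoad Q t ≤ Q - 1 := by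
  suffices h : ∑ t ∈ Finset.range T, doublingLoad Q t ≤ min (2 ^ T - 1) (Q - 1) from
    h.trans (min_le_right _ _)
  induction T with
  | zero => simp
  | succ T ih =>
    rw [Finset.sum_range_succ, doublingLoad, pow_succ]
    have := Nat.one_le_two_pow (n := T)
    omega

theorem sum_mul_doublingLoad_le (Q T : ℕ) (ω : ℝ≥0) :
    ∑ t ∈ Finset.range T, (doublingLoad Q t : ℝ≥0) * ω ≤ ((Q - 1 : ℕ) : ℝ≥0) * ω := by
  rw [← Finset.sum_mul]
  gcongr
  exact_mod_cast sum_doublingLoad_le Q T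

theorem sum_le_doublingLoad_mul {ι : Type*} {w : ι → ℝ≥0} {ω : ℝ≥0} (hw : ∀ x, w x ≤ ω)
    {Q t : ℕ} (B : Finset ι) (f : ι → ℕ) (hf : Set.InjOn f B)
    (hB : ∀ x ∈ B, 2 ^ t ≤ f x ∧ f x < 2 ^ (t + 1) ∧ f x < Q) :
    ∑ x ∈ B, w x ≤ (doublingLoad Q t : ℝ≥0) * ω := by
  have hcard : B.card ≤ doublingLoad Q t := by
    have h := Finset.card_le_card_of_injOn (t := Finset.Ico (2 ^ t) (min (2 ^ (t + 1)) Q)) f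
      (fun x hx => by
        have := hB x hx
        simp only [Finset.coe_Ico, Set.mem_Ico]
        omega) hf
    rw [Nat.card_Ico] at h
    unfold doublingLoad
    rw [pow_succ] at h
    omega
  calc ∑ x ∈ B, w x ≤ B.card • ω := Finset.sum_le_card_nsmul _ _ _ fun x _ => hw x
    _ = (B.card : ℝ≥0) * ω := nsmul_eq_mul _ _
    _ ≤ _ := by gcongr

/-- Simultaneous binomial scatters in disjoint groups `g`, each of `Q` slots: if slot `(g, 0)` holds
all packets owned by slots of its group, then these can be brought to their owners `o x` in `T`
rounds, provided `Q ≤ 2 ^ T`. -/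
theorem exists_scatter {V ι G : Type*} [Fintype V] [Fintype ι] {w : ι → ℝ≥0} {ω : ℝ≥0}
    (hw : ∀ x, w x ≤ ω) {Q : ℕ} (e : G × Fin Q → V) (he : Function.Injective e)
    (o : ι → G × Fin Q) (ho : Function.Injective o) {T : ℕ} (hT : Q ≤ 2 ^ T) (H : V → Set ι)
    (hH : ∀ x, ∀ j : Fin Q, j.val = 0 → x ∈ H (e ((o x).1, j))) :
    ∃ H', Reaches w T (((Q - 1 : ℕ) : ℝ≥0) * ω) H H' ∧ (∀ v, H v ⊆ H' v) ∧
      ∀ x, x ∈ H' (e (o x)) := by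
  classical
  suffices key : ∀ (T : ℕ) (H : V → Set ι),
      -- At level `T` the slots at multiples of `2 ^ T` hold the packets of the next `2 ^ T` slots.
      (∀ x, ∀ j : Fin Q, 2 ^ T ∣ j.val → j.val ≤ (o x).2 → (o x).2 < j.val + 2 ^ T →
        x ∈ H (e ((o x).1, j))) →
      ∃ H', Reaches w T (∑ t ∈ Finset.range T, (doublingLoad Q t : ℝ≥0) * ω) H H' ∧
        (∀ v, H v ⊆ H' v) ∧ ∀ x, x ∈ H' (e (o x)) by
    obtain ⟨H', ⟨L, h1, h2, h3, h4⟩, h5⟩ := key T H fun x j hj _ _ =>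
      hH x j (Nat.eq_zero_of_dvd_of_lt hj (j.isLt.trans_le hT))
    exact ⟨H', ⟨L, h1, h2, h3, h4.trans (sum_mul_doublingLoad_le Q T ω)⟩, h5⟩
  intro T
  induction T with
  | zero =>
    intro H hH
    refine ⟨H, by simpa using Reaches.refl H, fun v => le_rfl, fun x => ?_⟩
    exact hH x (o x).2 (by simp) le_rfl (by simp)
  | succ T ih =>
    intro H hH
    let κ := {c : G × Fin Q // c.2.val + 2 ^ T < Q}
    let up : κ → G × Fin Q := fun c => (c.1.1, ⟨c.1.2.val + 2 ^ T, c.2⟩)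
    have hup : Function.Injective up := by
      rintro ⟨⟨g, j⟩, h⟩ ⟨⟨g', j'⟩, h'⟩ hc
      simp only [up, Prod.mk.injEq, Fin.mk.injEq, add_left_inj] at hc
      obtain ⟨rfl, hc⟩ := hc
      obtain rfl := Fin.ext hc
      rfl
    let B : κ → Finset ι := fun c => Finset.univ.filter fun x =>
      (o x).1 = c.1.1 ∧ c.1.2.val + 2 ^ T ≤ (o x).2 ∧ (o x).2 < c.1.2.val + 2 ^ (T + 1)
    obtain ⟨H₁, hr, hm, ht⟩ := exists_reaches_of_transfers (fun c : κ => e c.1) (fun c => e (up c))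
      (he.comp Subtype.val_injective) (he.comp hup) B w ((doublingLoad Q T : ℝ≥0) * ω) (by
        intro c
        refine sum_le_doublingLoad_mul hw _ (fun x => (o x).2.val - c.1.2.val) ?_ ?_
        · intro x hx y hy hxy
          simp only [B, Finset.coe_filter, Finset.mem_univ, true_and, Set.mem_ofPred_eq] at hx hy
          refine ho (Prod.ext (hx.1.trans hy.1.symm) (Fin.ext ?_))
          dsimp only at hxy
          omega
        · intro x hx
          simp only [B, Finset.mem_filter, Finset.mem_univ, true_and] at hx
          have := (o x).2.isLt
          omega) H
    obtain ⟨H₂, hr', hm', hf⟩ := ih H₁ (by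
      intro x j hj hjx hxj
      obtain ⟨a, ha⟩ := hj
      have hp : 2 ^ (T + 1) = 2 ^ T * 2 := pow_succ _ _
      rcases Nat.even_or_odd' a with ⟨b, rfl | rfl⟩
      · refine hm _ (hH x j ⟨b, by rw [ha, hp, mul_assoc]⟩ hjx (by omega))
      · have hb : 2 ^ T * (2 * b + 1) = 2 ^ (T + 1) * b + 2 ^ T := by rw [hp]; ring
        have hlt := j.isLt
        let c : κ := ⟨((o x).1, ⟨2 ^ (T + 1) * b, by omega⟩), by dsimp only; omega⟩
        have hc : e (up c) = e ((o x).1, j) :=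
          congrArg e (Prod.ext rfl (Fin.ext (by simp only [up, c]; omega)))
        rw [← hc]
        refine ht c x ?_ (hH x _ (Dvd.intro _ rfl) ?_ ?_)
        · simp only [B, c, Finset.mem_filter, Finset.mem_univ, true_and]
          omega
        · dsimp only; omega
        · dsimp only; omega)
    refine ⟨H₂, ?_, fun v => (hm v).trans (hm' v), hf⟩
    rw [Finset.sum_range_succ, add_comm T, add_comm (∑ _ ∈ _, _)]
    exact hr.trans hr'

/-- All-gather on a circulant graph. Slot `a` is operated by a sender `S a` and a receiver `D a`,
which coincide unless `S a` holds all packets from the beginning. If every packet `x` is held by its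
owner `o x`, then `T` rounds with `p ≤ 2 ^ T` make all packets known to all receivers. -/
theorem exists_allGather {V ι : Type*} [Fintype V] [Fintype ι] {w : ι → ℝ≥0} {ω : ℝ≥0}
    (hw : ∀ x, w x ≤ ω) {p : ℕ} [NeZero p] (S D : Fin p → V) (hS : Function.Injective S)
    (hD : Function.Injective D) (o : ι → Fin p) (ho : Function.Injective o) {T : ℕ}
    (hT : p ≤ 2 ^ T) (H : V → Set ι) (hH : ∀ x, x ∈ H (D (o x)))
    (hSD : ∀ a, S a = D a ∨ ∀ x, x ∈ H (S a)) :
    ∃ H', Reaches w T (((p - 1 : ℕ) : ℝ≥0) * ω) H H' ∧ ∀ a x, x ∈ H' (D a) := by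
  classical
  suffices key : ∀ T : ℕ, ∃ H',
      Reaches w T (∑ t ∈ Finset.range T, (doublingLoad p t : ℝ≥0) * ω) H H' ∧
        (∀ v, H v ⊆ H' v) ∧ ∀ a x, (o x - a).val < 2 ^ T → x ∈ H' (D a) by
    obtain ⟨H', ⟨L, h1, h2, h3, h4⟩, -, h5⟩ := key T
    exact ⟨H', ⟨L, h1, h2, h3, h4.trans (sum_mul_doublingLoad_le p T ω)⟩,
      fun a x => h5 a x ((o x - a).isLt.trans_le hT)⟩
  intro T
  induction T with
  | zero =>
    refine ⟨H, by simpa using Reaches.refl H, fun v => le_rfl, fun a x h => ?_⟩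
    have h0 : o x - a = 0 := Fin.ext (by simpa using h)
    rw [← sub_eq_zero.1 h0]
    exact hH x
  | succ T ih =>
    obtain ⟨H₁, hr, hm, hf⟩ := ih
    obtain ⟨H₂, hr', hm', ht⟩ := exists_reaches_of_transfers
      (fun a => S (a + Fin.ofNat p (2 ^ T))) D (hS.comp (add_left_injective _)) hD
      (fun a => Finset.univ.filter fun x => 2 ^ T ≤ (o x - a).val ∧ (o x - a).val < 2 ^ (T + 1)) w
      ((doublingLoad p T : ℝ≥0) * ω) (by
        intro a
        refine sum_le_doublingLoad_mul hw _ (fun x => (o x - a).val) ?_ ?_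
        · intro x _ y _ hxy
          exact ho (sub_left_injective (Fin.ext hxy))
        · intro x hx
          simp only [Finset.mem_filter, Finset.mem_univ, true_and] at hx
          exact ⟨hx.1, hx.2, (o x - a).isLt⟩) H₁
    refine ⟨H₂, ?_, fun v => (hm v).trans (hm' v), fun a x hx => ?_⟩
    · rw [Finset.sum_range_succ]
      exact hr.trans hr'
    · by_cases hlt : (o x - a).val < 2 ^ T
      · exact hm' _ (hf a x hlt)
      · refine ht a x (by simp only [Finset.mem_filter, Finset.mem_univ, true_and]; omega) ?_
        rcases hSD (a + Fin.ofNat p (2 ^ T)) with h | h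
        · rw [h]
          refine hf _ x ?_
          have hp : 2 ^ T < p := by have := (o x - a).isLt; omega
          have hval : (Fin.ofNat p (2 ^ T)).val = 2 ^ T := Nat.mod_eq_of_lt hp
          rw [← sub_sub, Fin.sub_val_of_le (by rw [Fin.le_def, hval]; omega), hval]
          rw [pow_succ] at hx
          omega
        · exact hm _ (h x)

/-! ### Several broadcasting nodes -/

/-- The splitting of each message into `q` packets of equal size. -/
noncomputable def Packetization.equal (r n : ℕ) {q : ℕ} (hq : q ≠ 0) : Packetization r n where
  count := q
  size _ _ := n / q
  sum_size i := by
    rw [Finset.sum_const, Finset.card_univ, Fintype.card_fin, nsmul_eq_mul]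
    exact mul_div_cancel₀ _ (Nat.cast_ne_zero.2 hq)

theorem multiBroadcastWithin_of_two_le {V : Type*} [Fintype V] {p r n k : ℕ} (hr : 2 ≤ r)
    (hrp : r ≤ p) (hk : p ≤ 2 ^ k) (src : Fin r → V) (hsrc : Function.Injective src) (D : Finset V)
    (hD : D.card = p) {α β : ℝ} (hα : 0 ≤ α) (hβ : 0 ≤ β) :
    MultiBroadcastWithin src D n α β (2 * (k * α + r * n * β)) := by
  obtain ⟨q, hq⟩ : ∃ q, q = p / r := ⟨_, rfl⟩
  have hq1 : 0 < q := hq ▸ Nat.div_pos hrp (by omega)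
  have hrq : r * q ≤ p := hq ▸ Nat.mul_div_le p r
  have hpq : p + 1 ≤ r * q + r := by
    have := Nat.lt_mul_div_succ p (show 0 < r by omega)
    rw [← hq, mul_add, mul_one] at this
    omega
  obtain ⟨k, rfl⟩ : ∃ l, k = l + 1 := by
    refine ⟨k - 1, ?_⟩
    rcases k with _ | k
    · simp only [pow_zero] at hk; omega
    · rfl
  have hqk : q ≤ 2 ^ k := by
    have : 2 * q ≤ r * q := Nat.mul_le_mul_right q hr
    rw [pow_succ] at hk
    omega
  have : NeZero p := ⟨by omega⟩
  let P := Packetization.equal r n hq1.ne'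
  let w : P.Packet → ℝ≥0 := fun x => P.size x.1 x.2
  let dst : Fin p → V := fun a => ((Finset.equivFinOfCardEq hD).symm a : V)
  have hdst : Function.Injective dst :=
    Subtype.val_injective.comp (Finset.equivFinOfCardEq hD).symm.injective
  let slot : Fin r × Fin q → Fin p := fun x => Fin.castLE hrq (finProdFinEquiv x)
  have hslot : Function.Injective slot :=
    (Fin.castLE_injective hrq).comp finProdFinEquiv.injective
  let z : Fin q := ⟨0, hq1⟩
  let B : Fin r → Finset P.Packet := fun i => {i} ×ˢ Finset.univ
  have hw : ∀ x : P.Packet, w x ≤ n / q := fun x => le_rfl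
  obtain ⟨H₁, hr₁, -, ht⟩ := exists_reaches_of_transfers src (fun i => dst (slot (i, z))) hsrc
    (fun i j h => (Prod.ext_iff.1 (hslot (hdst h))).1) B w n
    (fun i => by
      rw [Finset.sum_product, Finset.sum_singleton]
      exact (P.sum_size i).le)
    (initialHoldings src P)
  obtain ⟨H₂, hr₂, -, hs⟩ := exists_scatter hw (fun x => dst (slot x)) (hdst.comp hslot)
    (fun x : P.Packet => (x : Fin r × Fin q)) (fun _ _ h => h) hqk H₁ (by
      intro x j hj
      obtain rfl : j = z := Fin.ext hj
      exact ht x.1 x (Finset.mem_product.2 ⟨Finset.mem_singleton_self _, Finset.mem_univ _⟩) rfl)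
  obtain ⟨H₃, hr₃, hg⟩ := exists_allGather hw dst dst hdst hdst (fun x : P.Packet => slot x) hslot hk
    H₂ hs fun a => Or.inl rfl
  refine MultiBroadcastWithin.of_reaches (k := 2 * (k + 1)) hα hβ P ((hr₁.trans hr₂).trans hr₃) ?_
    (by omega) ?_
  · intro d hd x
    have := hg (Finset.equivFinOfCardEq hD ⟨d, hd⟩) x
    simpa [dst] using this
  · have hC : ((n + ((q - 1 : ℕ) : ℝ≥0) * (n / q) + ((p - 1 : ℕ) : ℝ≥0) * (n / q) : ℝ≥0) : ℝ)
        ≤ 2 * (r * n) := by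
      simp only [NNReal.coe_add, NNReal.coe_mul, NNReal.coe_div, NNReal.coe_natCast,
        Nat.cast_sub (show 1 ≤ q from hq1), Nat.cast_sub (show 1 ≤ p by omega), Nat.cast_one]
      have hqR : (1 : ℝ) ≤ q := by exact_mod_cast hq1
      have hrR : (2 : ℝ) ≤ r := by exact_mod_cast hr
      have hpR : (p : ℝ) + 1 ≤ r * q + r := by exact_mod_cast hpq
      have hn : (0 : ℝ) ≤ n := Nat.cast_nonneg n
      have h : (n : ℝ) + (q - 1) * (n / q) + (p - 1) * (n / q) =
          n * ((q + (q - 1) + (p - 1)) / q) := by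
        field_simp
      rw [h, show 2 * ((r : ℝ) * n) = n * (2 * r) by ring]
      refine mul_le_mul_of_nonneg_left ?_ hn
      rw [div_le_iff₀ (by linarith)]
      -- With `p + 1 ≤ r q + r`, the two sides differ by at least `(q - 1) (r - 2) + 1`.
      nlinarith [mul_nonneg (sub_nonneg.2 hqR) (sub_nonneg.2 hrR)]
    have := mul_le_mul_of_nonneg_right hC hβ
    rw [Nat.cast_mul, Nat.cast_two]
    linarith

/-! ### A single broadcasting node -/

theorem multiBroadcastWithin_one {V : Type*} [Fintype V] {p n k : ℕ} (hp : 2 ≤ p)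
    (hk : p ≤ 2 ^ k) (src : Fin 1 → V) (D : Finset V) (hD : D.card = p) {α β : ℝ} (hα : 0 ≤ α)
    (hβ : 0 ≤ β) : MultiBroadcastWithin src D n α β (2 * (k * α + n * β)) := by
  classical
  obtain ⟨m, rfl⟩ : ∃ m, p = m + 1 := ⟨p - 1, by omega⟩
  have hm : m ≠ 0 := by omega
  let P := Packetization.equal 1 n hm
  let w : P.Packet → ℝ≥0 := fun x => P.size x.1 x.2
  obtain ⟨E, hE⟩ : ∃ E : Fin (m + 1) ≃ D, src 0 ∈ D → (E 0 : V) = src 0 := by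
    let E := (Finset.equivFinOfCardEq hD).symm
    by_cases h : src 0 ∈ D
    · exact ⟨(Equiv.swap 0 (E.symm ⟨_, h⟩)).trans E, fun _ => by simp⟩
    · exact ⟨E, fun h' => absurd h' h⟩
  let dst : Fin (m + 1) → V := fun a => (E a : V)
  have hdst : Function.Injective dst := Subtype.val_injective.comp E.injective
  let snd : Fin (m + 1) → V := fun a => if a = 0 then src 0 else dst a
  have hsnd_succ : ∀ a, a ≠ 0 → snd a = dst a := fun a ha => if_neg ha
  have hne : ∀ a, a ≠ 0 → src 0 ≠ dst a := by
    intro a ha h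
    have h0 : dst 0 = dst a := (hE (h ▸ (E a).2)).trans h
    exact ha (hdst h0).symm
  have hsnd : Function.Injective snd := by
    intro a b h
    by_cases ha : a = 0 <;> by_cases hb : b = 0
    · rw [ha, hb]
    · rw [hsnd_succ b hb, ha] at h
      exact absurd h (hne b hb)
    · rw [hsnd_succ a ha, hb] at h
      exact absurd h.symm (hne a ha)
    · rw [hsnd_succ a ha, hsnd_succ b hb] at h
      exact hdst h
  let o : P.Packet → Fin (m + 1) := fun x => Fin.succ (show Fin m from x.2)
  have ho : Function.Injective o := fun x y h =>
    Prod.ext (Subsingleton.elim _ _) (Fin.succ_injective m h)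
  have hw : ∀ x : P.Packet, w x ≤ n / m := fun x => le_rfl
  have hinit : ∀ x, x ∈ initialHoldings src P (src 0) := fun x =>
    congrArg src (Subsingleton.elim x.1 0)
  obtain ⟨H₁, hr₁, hmono, hs⟩ := exists_scatter hw (G := Unit) (fun x => snd x.2)
    (fun x y h => Prod.ext rfl (hsnd h)) (fun x => ((), o x))
    (fun x y h => ho (Prod.ext_iff.1 h).2) hk (initialHoldings src P) (by
      intro x j hj
      obtain rfl : j = 0 := Fin.ext hj
      exact hinit x)
  obtain ⟨H₂, hr₂, hg⟩ := exists_allGather hw snd dst hsnd hdst o ho hk H₁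
    (fun x => by
      rw [← hsnd_succ (o x) (Fin.succ_ne_zero _)]
      exact hs x)
    (fun a => by
      by_cases ha : a = 0
      · right
        intro x
        rw [ha]
        exact hmono _ (hinit x)
      · exact Or.inl (hsnd_succ a ha))
  refine MultiBroadcastWithin.of_reaches (k := 2 * k) hα hβ P (hr₁.trans hr₂) ?_ (by omega) ?_
  · intro d hd x
    have := hg (E.symm ⟨d, hd⟩) x
    simpa [dst] using this
  · have hmR : (m : ℝ) ≠ 0 := Nat.cast_ne_zero.2 hm
    push_cast [Nat.add_sub_cancel]
    rw [mul_div_cancel₀ _ hmR]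
    linarith

theorem mainTheorem2 {V : Type*} [Fintype V] (p r n : ℕ) (hr : 1 ≤ r) (hrp : r ≤ p) (hp : 2 ≤ p)
    (src : Fin r → V) (hsrc : Function.Injective src) (D : Finset V) (hD : D.card = p)
    (α β : ℝ) (hα : 0 ≤ α) (hβ : 0 ≤ β) :
    MultiBroadcastWithin src D n α β
      (2 * ((⌈Real.logb 2 (p : ℝ)⌉ : ℝ) * α + (r : ℝ) * (n : ℝ) * β)) := by
  have hlog : ⌈Real.logb 2 (p : ℝ)⌉ = (Nat.clog 2 p : ℤ) := by
    have h := Real.ceil_logb_natCast (b := 2) (r := (p : ℝ)) (Nat.cast_nonneg p)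
    rw [Int.clog_natCast] at h
    exact_mod_cast h
  have hk : p ≤ 2 ^ Nat.clog 2 p := Nat.le_pow_clog one_lt_two p
  rw [hlog, Int.cast_natCast]
  rcases hr.eq_or_lt with rfl | hr
  · simpa using multiBroadcastWithin_one hp hk src D hD hα hβ
  · exact multiBroadcastWithin_of_two_le hr hrp hk src hsrc D hD hα hβ
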